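/- Let $G$ be a finite simple graph with at least one edge, let $K$ be a field, and let $R=K[x_v : v\in V(G)]$ with the standard grading. Let $J(G)\subseteq R$ be the cover ideal of $G$, generated by the monomials $\prod_{v\in C}x_v$ with $C$ a minimal vertex cover of $G$. For an ideal $I\subseteq R$ and $k\ge 0$, let $I^{(k)}=\bigcap_{P}\,(I^kR_P\cap R)$ be its $k$-th symbolic power, where $P$ ranges over $\operatorname{Ass}(R/I)$ or, in the other common definition, over the minimal primes of $I$. For a nonzero graded ideal $I$, let $\alpha(I)$ be the least degree of a nonzero homogeneous element of $I$, and for a proper graded ideal $I$ let $\operatorname{v}(I)$ be the least $d\ge 0$ such that there is a homogeneous $f\in R$ of degree $d$ for which $I:f$ is an associated prime of $R/I$. Suppose that for every odd cycle $C$ of $G$ and every vertex $i\in V(G)$ there is a vertex $j$ of $C$ with $\{i,j\}\in E(G)$. Then, for either definition of the symbolic powers, the following limit exists and $$\lim_{k\to\infty}\frac{\operatorname{v}(J(G)^{(k)})}{k}=\min\Big\{\alpha(J(G)),\frac{|V(G)|}{2}\Big\}.$$ -/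

import Mathlib

/-- The contraction `I R_P ∩ R` of the extension of an ideal `I` of `R` to the localization
`R_P` at a prime ideal `P`. -/
noncomputable def contractionAtPrime {R : Type*} [CommRing R] (P : Ideal R) [P.IsPrime]
    (I : Ideal R) : Ideal R :=
  (I.map (algebraMap R (Localization.AtPrime P))).comap (algebraMap R (Localization.AtPrime P))

/-- The `k`-th symbolic power `⋂_{P ∈ Ass(R/I)} (I^k R_P ∩ R)` of an ideal `I`. -/
noncomputable def symbolicPowerAss {R : Type*} [CommRing R] (I : Ideal R) (k : ℕ) : Ideal R :=
  ⨅ P : associatedPrimes R (R ⧸ I),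
    haveI : P.1.IsPrime := P.2.isPrime
    contractionAtPrime P.1 (I ^ k)

/-- The `k`-th symbolic power in the variant `⋂_{P ∈ Min(I)} (I^k R_P ∩ R)` that uses only the
minimal primes of `I`. -/
noncomputable def symbolicPowerMin {R : Type*} [CommRing R] (I : Ideal R) (k : ℕ) : Ideal R :=
  ⨅ P : I.minimalPrimes,
    haveI : P.1.IsPrime := P.2.1.1
    contractionAtPrime P.1 (I ^ k)

/-- The v-number of a proper graded ideal `I` of the standard graded polynomial ring: the least `d`
such that `I : f` is an associated prime of `R / I` for some homogeneous `f` of degree `d`. -/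
noncomputable def vNumber {σ K : Type*} [Field K] (I : Ideal (MvPolynomial σ K)) : ℕ :=
  sInf {d : ℕ | ∃ f : MvPolynomial σ K, f.IsHomogeneous d ∧
    ∃ p ∈ associatedPrimes (MvPolynomial σ K) (MvPolynomial σ K ⧸ I),
      Submodule.colon I {f} = p}

/-- The initial degree `α(I)`: the least degree of a nonzero homogeneous element of a nonzero
graded ideal `I`. -/
noncomputable def initialDegree {σ K : Type*} [Field K] (I : Ideal (MvPolynomial σ K)) : ℕ :=
  sInf {d : ℕ | ∃ f ∈ I, f ≠ 0 ∧ f.IsHomogeneous d}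

/-- The cover ideal `J(G)` in `K[x_v : v ∈ V]`, generated by the monomials `∏_{v ∈ C} x_v` for `C`
a minimal vertex cover of `G`. -/
noncomputable def coverIdeal (K : Type*) [Field K] {V : Type*} (G : SimpleGraph V) :
    Ideal (MvPolynomial V K) :=
  Ideal.span {m | ∃ C : Finset V,
    Minimal (fun D : Finset V => G.IsVertexCover (D : Set V)) C ∧
      m = ∏ v ∈ C, MvPolynomial.X v}

/-! The cover ideal `J` is the intersection of the primes `(x_i, x_j)` over the edges, so both
symbolic powers are spanned by the monomials whose exponents satisfy `m i + m j ≥ k` on every edge.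
The v-number of such a power differs from its initial degree by a bounded amount.

Lower bound: if `I : f` is prime, it contains a variable `x_v`, so `x_v f` is a nonzero element of
the symbolic power. Its degree is at least `k · min(α, |V|/2)`: `mul_min_le_two_mul_sum` slices the
exponent into half-integral covers, and `min_le_sum_of_two_le_add` bounds each slice. There the
vertices of weight one half either induce a bipartite graph, and the slice splits into two covers,
or contain an odd cycle, and the hypothesis forces every vertex to have weight at least one half.

Upper bound: perturbing `k` times a minimum cover, or the constant `k/2`, gives a monomial that
fails the edge inequality at a single edge and only by one. Its colon ideal is that edge's prime. -/

/-! ### Order of vanishing along a coordinate subspace -/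

section OrderIdeal

/-- The homomorphism multiplying the variables in `s` by an auxiliary variable. -/
noncomputable def orderHom (K : Type*) [Field K] {σ : Type*} [DecidableEq σ] (s : Finset σ) :
    MvPolynomial σ K →ₐ[K] Polynomial (MvPolynomial σ K) :=
  MvPolynomial.aeval fun v =>
    Polynomial.C (MvPolynomial.X v) * if v ∈ s then Polynomial.X else 1

/-- The ideal of polynomials all of whose monomials have degree at least `k` in the variables
from `s`. -/
noncomputable def orderIdeal (K : Type*) [Field K] {σ : Type*} [DecidableEq σ] (s : Finset σ)
    (k : ℕ) : Ideal (MvPolynomial σ K) :=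
  (Ideal.span {Polynomial.X ^ k}).comap (orderHom K s)

variable {K : Type*} [Field K] {σ : Type*} [DecidableEq σ]

theorem orderHom_monomial (s : Finset σ) (m : σ →₀ ℕ) (c : K) :
    orderHom K s (MvPolynomial.monomial m c) =
      Polynomial.C (MvPolynomial.monomial m c) * Polynomial.X ^ (∑ v ∈ s, m v) := by
  classical
  rw [orderHom, MvPolynomial.aeval_monomial, Finsupp.prod]
  simp only [mul_pow, Finset.prod_mul_distrib]
  rw [MvPolynomial.monomial_eq, map_mul, ← mul_assoc, Finsupp.prod, map_prod]
  simp only [map_pow]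
  congr 1
  rw [← Finset.prod_pow_eq_pow_sum]
  simp only [ite_pow, one_pow]
  rw [Finset.prod_ite, Finset.prod_const_one, mul_one, Finset.filter_mem_eq_inter]
  apply Finset.prod_subset Finset.inter_subset_right
  intro v hv hv'
  have : m v = 0 := by
    by_contra h
    exact hv' (Finset.mem_inter.2 ⟨Finsupp.mem_support_iff.2 h, hv⟩)
  simp [this]

theorem coeff_orderHom (s : Finset σ) (f : MvPolynomial σ K) (n : ℕ) (m : σ →₀ ℕ) :
    ((orderHom K s f).coeff n).coeff m = if ∑ v ∈ s, m v = n then f.coeff m else 0 := by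
  induction f using MvPolynomial.induction_on' with
  | monomial u a =>
    rw [orderHom_monomial, Polynomial.coeff_C_mul_X_pow]
    by_cases h : u = m
    · subst h
      by_cases h' : n = ∑ v ∈ s, u v
      · simp [h']
      · simp [h', Ne.symm h']
    · split_ifs <;> simp [MvPolynomial.coeff_monomial, h]
  | add p q hp hq =>
    rw [map_add, Polynomial.coeff_add, MvPolynomial.coeff_add, hp, hq, MvPolynomial.coeff_add]
    split_ifs <;> simp

theorem mem_orderIdeal {s : Finset σ} {k : ℕ} {f : MvPolynomial σ K} :
    f ∈ orderIdeal K s k ↔ ∀ m ∈ f.support, k ≤ ∑ v ∈ s, m v := by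
  rw [orderIdeal, Ideal.mem_comap, Ideal.mem_span_singleton, Polynomial.X_pow_dvd_iff]
  constructor
  · intro h m hm
    by_contra! hlt
    have := congrArg (MvPolynomial.coeff m) (h _ hlt)
    rw [coeff_orderHom, if_pos rfl, MvPolynomial.coeff_zero] at this
    exact MvPolynomial.mem_support_iff.1 hm this
  · intro h d hd
    ext m
    rw [coeff_orderHom, MvPolynomial.coeff_zero]
    split_ifs with hs
    · by_contra hm
      have := h m (MvPolynomial.mem_support_iff.2 hm)
      omega
    · rfl

theorem monomial_mem_orderIdeal {s : Finset σ} {k : ℕ} {m : σ →₀ ℕ} :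
    MvPolynomial.monomial m (1 : K) ∈ orderIdeal K s k ↔ k ≤ ∑ v ∈ s, m v := by
  classical
  rw [mem_orderIdeal, MvPolynomial.support_monomial, if_neg one_ne_zero]
  simp

theorem X_mem_orderIdeal_one {s : Finset σ} {v : σ} :
    (MvPolynomial.X v : MvPolynomial σ K) ∈ orderIdeal K s 1 ↔ v ∈ s := by
  rw [MvPolynomial.X, monomial_mem_orderIdeal]
  simp only [Finsupp.single_apply, Finset.sum_ite_eq]
  by_cases h : v ∈ s <;> simp [h]

instance isPrime_orderIdeal_one (s : Finset σ) : (orderIdeal K s 1).IsPrime := by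
  have : (Ideal.span {(Polynomial.X : Polynomial (MvPolynomial σ K)) ^ 1}).IsPrime := by
    rw [pow_one, Ideal.span_singleton_prime Polynomial.X_ne_zero]
    exact Polynomial.prime_X
  exact Ideal.comap_isPrime _ _

/-- The auxiliary variable is prime, so a factor it does not divide contributes nothing to the
order. -/
theorem mem_orderIdeal_of_mul_mem {s : Finset σ} {k : ℕ} {t f : MvPolynomial σ K}
    (ht : t ∉ orderIdeal K s 1) (h : t * f ∈ orderIdeal K s k) : f ∈ orderIdeal K s k := by
  rw [orderIdeal, Ideal.mem_comap, Ideal.mem_span_singleton] at *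
  rw [pow_one] at ht
  rw [map_mul] at h
  exact Polynomial.prime_X.pow_dvd_of_dvd_mul_left k ht h

theorem pow_le_orderIdeal {s : Finset σ} {I : Ideal (MvPolynomial σ K)}
    (h : I ≤ orderIdeal K s 1) (k : ℕ) : I ^ k ≤ orderIdeal K s k := by
  rw [orderIdeal, ← Ideal.map_le_iff_le_comap, pow_one] at h
  rw [orderIdeal, ← Ideal.map_le_iff_le_comap, Ideal.map_pow, ← Ideal.span_singleton_pow]
  exact Ideal.pow_right_mono h k

end OrderIdeal

/-! ### Contractions and associated primes as conditions on elements -/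

theorem mem_contractionAtPrime {R : Type*} [CommRing R] {P : Ideal R} [P.IsPrime] {I : Ideal R}
    {f : R} : f ∈ contractionAtPrime P I ↔ ∃ t ∉ P, t * f ∈ I := by
  rw [contractionAtPrime, Ideal.mem_comap,
    IsLocalization.algebraMap_mem_map_algebraMap_iff P.primeCompl]
  rfl

theorem mem_associatedPrimes_quotient {R : Type*} [CommRing R] [IsNoetherianRing R] {I P : Ideal R} :
    P ∈ associatedPrimes R (R ⧸ I) ↔ P.IsPrime ∧ ∃ f, Submodule.colon I {f} = P := by
  rw [AssociatedPrimes.mem_iff, IsAssociatedPrime, Submodule.isAssociatedPrime_iff]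
  refine and_congr_right fun _ => ?_
  have key (f : R) : (⊥ : Submodule R (R ⧸ I)).colon {Submodule.Quotient.mk f} =
      Submodule.colon I {f} := by
    ext r
    rw [Submodule.mem_colon_singleton, Submodule.mem_colon_singleton, ← Submodule.Quotient.mk_smul,
      Submodule.mem_bot, Submodule.Quotient.mk_eq_zero]
  constructor
  · rintro ⟨x, rfl⟩
    obtain ⟨f, rfl⟩ := Submodule.Quotient.mk_surjective _ x
    exact ⟨f, (key f).symm⟩
  · rintro ⟨f, rfl⟩
    exact ⟨_, (key f).symm⟩

/-! ### Primes and symbolic powers of the cover ideal -/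

section CoverIdeal

variable {K : Type*} [Field K] {V : Type*} {G : SimpleGraph V}

theorem prod_X_mem_coverIdeal {C : Finset V} (hC : G.IsVertexCover (C : Set V)) :
    ∏ v ∈ C, MvPolynomial.X v ∈ coverIdeal K G := by
  obtain ⟨D, hDC, hD⟩ := exists_minimal_le_of_wellFoundedLT
    (fun D : Finset V => G.IsVertexCover (D : Set V)) C hC
  exact Ideal.mem_of_dvd _ (Finset.prod_dvd_prod_of_subset _ _ _ hDC)
    (Ideal.subset_span ⟨D, hD, rfl⟩)

theorem monomial_mem_coverIdeal {m : V →₀ ℕ} (c : K)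
    (hm : G.IsVertexCover (m.support : Set V)) :
    MvPolynomial.monomial m c ∈ coverIdeal K G := by
  refine Ideal.mem_of_dvd _ ?_ (prod_X_mem_coverIdeal hm)
  rw [MvPolynomial.monomial_eq, Finsupp.prod]
  refine Dvd.dvd.mul_left (Finset.prod_dvd_prod_of_dvd _ _ fun v hv => ?_) _
  exact dvd_pow_self _ (Finsupp.mem_support_iff.1 hv)

variable [DecidableEq V]

theorem coverIdeal_le_orderIdeal {i j : V} (h : G.Adj i j) :
    coverIdeal K G ≤ orderIdeal K {i, j} 1 := by
  rw [coverIdeal, Ideal.span_le]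
  rintro _ ⟨C, hC, rfl⟩
  rcases hC.1 h with hi | hj
  · exact Ideal.mem_of_dvd _ (Finset.dvd_prod_of_mem _ hi) (X_mem_orderIdeal_one.2 (by simp))
  · exact Ideal.mem_of_dvd _ (Finset.dvd_prod_of_mem _ hj) (X_mem_orderIdeal_one.2 (by simp))

theorem mem_coverIdeal {f : MvPolynomial V K} :
    f ∈ coverIdeal K G ↔ ∀ i j, G.Adj i j → f ∈ orderIdeal K {i, j} 1 := by
  refine ⟨fun hf i j h => coverIdeal_le_orderIdeal h hf, fun h => ?_⟩
  rw [f.as_sum]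
  refine Ideal.sum_mem _ fun m hm => monomial_mem_coverIdeal _ fun i j hij => ?_
  have := mem_orderIdeal.1 (h i j hij) m hm
  rw [Finset.sum_pair hij.ne] at this
  simp only [Finset.mem_coe, Finsupp.mem_support_iff]
  omega

variable [Fintype V]

theorem coverIdeal_eq_finset_inf [DecidableRel G.Adj] :
    coverIdeal K G = (Finset.univ.filter fun e : V × V => G.Adj e.1 e.2).inf
      fun e => orderIdeal K {e.1, e.2} 1 := by
  ext f
  rw [mem_coverIdeal]
  simp [Submodule.mem_finsetInf]

theorem exists_orderIdeal_le_of_isPrime {P : Ideal (MvPolynomial V K)} [hP : P.IsPrime]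
    (h : coverIdeal K G ≤ P) : ∃ i j, G.Adj i j ∧ orderIdeal K {i, j} 1 ≤ P := by
  classical
  rw [coverIdeal_eq_finset_inf, hP.inf_le'] at h
  obtain ⟨e, he, hle⟩ := h
  exact ⟨e.1, e.2, (Finset.mem_filter.1 he).2, hle⟩

theorem minimalPrimes_coverIdeal :
    (coverIdeal K G).minimalPrimes = {P | ∃ i j, G.Adj i j ∧ P = orderIdeal K {i, j} 1} := by
  ext P
  constructor
  · rintro ⟨⟨hP, hle⟩, hmin⟩
    obtain ⟨i, j, hij, h⟩ := exists_orderIdeal_le_of_isPrime hle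
    exact ⟨i, j, hij, le_antisymm (hmin ⟨inferInstance, coverIdeal_le_orderIdeal hij⟩ h) h⟩
  · rintro ⟨i, j, hij, rfl⟩
    refine ⟨⟨inferInstance, coverIdeal_le_orderIdeal hij⟩, fun Q ⟨hQ, hle⟩ hQP => ?_⟩
    obtain ⟨a, b, hab, h⟩ := exists_orderIdeal_le_of_isPrime hle
    have key (v : V) (hv : v ∈ ({a, b} : Finset V)) : v ∈ ({i, j} : Finset V) :=
      X_mem_orderIdeal_one.1 (hQP (h (X_mem_orderIdeal_one (K := K).2 hv)))
    have heq : ({a, b} : Finset V) = {i, j} := by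
      refine Finset.eq_of_subset_of_card_le key ?_
      rw [Finset.card_pair hab.ne, Finset.card_pair hij.ne]
    rwa [← heq]

/-- For an intersection of primes, the colon by `f` is the intersection of those primes that avoid
`f`. If it is prime, it equals one of them. -/
theorem associatedPrimes_coverIdeal :
    associatedPrimes (MvPolynomial V K) (MvPolynomial V K ⧸ coverIdeal K G) =
      (coverIdeal K G).minimalPrimes := by
  apply Set.Subset.antisymm
  · intro P hP
    classical
    obtain ⟨hP, f, rfl⟩ := mem_associatedPrimes_quotient.1 hP
    have hle : (Finset.univ.filter fun e : V × V =>
        G.Adj e.1 e.2 ∧ f ∉ orderIdeal K {e.1, e.2} 1).inf (fun e => orderIdeal K {e.1, e.2} 1) ≤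
          Submodule.colon (coverIdeal K G) {f} := by
      intro r hr
      rw [Submodule.mem_finsetInf] at hr
      rw [Submodule.mem_colon_singleton, smul_eq_mul, mem_coverIdeal]
      intro i j hij
      by_cases hf : f ∈ orderIdeal K {i, j} 1
      · exact Ideal.mul_mem_left _ _ hf
      · exact Ideal.mul_mem_right _ _ (hr (i, j) (by simp [hij, hf]))
    obtain ⟨e, he, hle⟩ := hP.inf_le'.1 hle
    obtain ⟨-, he, hf⟩ := Finset.mem_filter.1 he
    rw [minimalPrimes_coverIdeal]
    refine ⟨e.1, e.2, he, le_antisymm (fun r hr => ?_) hle⟩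
    rw [Submodule.mem_colon_singleton, smul_eq_mul] at hr
    exact (Ideal.IsPrime.mem_or_mem inferInstance (coverIdeal_le_orderIdeal he hr)).resolve_right hf
  · have := Module.associatedPrimes.minimalPrimes_annihilator_subset_associatedPrimes (MvPolynomial V K)
      (MvPolynomial V K ⧸ coverIdeal K G)
    rwa [Ideal.annihilator_quotient] at this

/-- All vertices but one form a cover, so the product of the variables off the edge, a unit at the
edge prime, enters `J` once multiplied by `x_i` or by `x_j`. The monomial supplies `k` such factors.
-/
theorem pow_prod_mul_monomial_mem_coverIdeal_pow {i j : V} (h : G.Adj i j) {k : ℕ} {m : V →₀ ℕ}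
    (c : K) (hm : k ≤ m i + m j) :
    (∏ v ∈ {i, j}ᶜ, MvPolynomial.X v) ^ k * MvPolynomial.monomial m c ∈ coverIdeal K G ^ k := by
  have hcov {a b : V} (hab : G.Adj a b) : (∏ v ∈ {a, b}ᶜ, MvPolynomial.X v) * MvPolynomial.X a ∈
      coverIdeal K G := by
    have hcover : G.IsVertexCover ((insert a {a, b}ᶜ : Finset V) : Set V) := by
      intro x y hxy
      have := hxy.ne
      simp only [Finset.coe_insert, Set.mem_insert_iff, Finset.mem_coe, Finset.mem_compl,
        Finset.mem_insert, Finset.mem_singleton]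
      grind
    have := prod_X_mem_coverIdeal (K := K) hcover
    rwa [Finset.prod_insert (by simp), mul_comm] at this
  obtain ⟨p, q, hp, hq, rfl⟩ : ∃ p q, p ≤ m i ∧ q ≤ m j ∧ k = p + q :=
    ⟨min k (m i), k - min k (m i), by omega, by omega, by omega⟩
  have hdvd : (MvPolynomial.X i ^ p * MvPolynomial.X j ^ q : MvPolynomial V K) ∣
      MvPolynomial.monomial m c := by
    rw [MvPolynomial.monomial_eq, Finsupp.prod_fintype _ _ (by simp)]
    refine Dvd.dvd.mul_left ?_ _
    refine dvd_trans ?_ (Finset.prod_dvd_prod_of_subset _ _ _ (Finset.subset_univ {i, j}))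
    rw [Finset.prod_pair h.ne]
    exact mul_dvd_mul (pow_dvd_pow _ hp) (pow_dvd_pow _ hq)
  refine Ideal.mem_of_dvd _ (mul_dvd_mul_left _ hdvd) ?_
  have h1 := Ideal.pow_mem_pow (hcov h) p
  have h2 := Ideal.pow_mem_pow (hcov h.symm) q
  rw [Finset.pair_comm] at h2
  rw [pow_add (coverIdeal K G)]
  convert Ideal.mul_mem_mul h1 h2 using 1
  ring

theorem contractionAtPrime_coverIdeal_pow {i j : V} (h : G.Adj i j) (k : ℕ)
    {P : Ideal (MvPolynomial V K)} [P.IsPrime] (hP : P = orderIdeal K {i, j} 1) :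
    contractionAtPrime P (coverIdeal K G ^ k) = orderIdeal K {i, j} k := by
  subst hP
  ext f
  rw [mem_contractionAtPrime]
  constructor
  · rintro ⟨t, ht, htf⟩
    exact mem_orderIdeal_of_mul_mem ht (pow_le_orderIdeal (coverIdeal_le_orderIdeal h) k htf)
  · intro hf
    refine ⟨(∏ v ∈ {i, j}ᶜ, MvPolynomial.X v) ^ k, fun hmem => ?_, ?_⟩
    · have := (isPrime_orderIdeal_one _).mem_of_pow_mem _ hmem
      rw [Ideal.IsPrime.prod_mem_iff] at this
      obtain ⟨v, hv, hv'⟩ := this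
      exact Finset.mem_compl.1 hv ((X_mem_orderIdeal_one (K := K)).1 hv')
    · rw [f.as_sum, Finset.mul_sum]
      refine Ideal.sum_mem _ fun m hm => pow_prod_mul_monomial_mem_coverIdeal_pow h _ ?_
      rw [← Finset.sum_pair h.ne]
      exact mem_orderIdeal.1 hf m hm

theorem mem_symbolicPowerMin_coverIdeal {k : ℕ} {f : MvPolynomial V K} :
    f ∈ symbolicPowerMin (coverIdeal K G) k ↔
      ∀ m ∈ f.support, ∀ i j, G.Adj i j → k ≤ m i + m j := by
  rw [symbolicPowerMin, Submodule.mem_iInf]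
  have hmem {i j : V} (h : G.Adj i j) :
      f ∈ orderIdeal K {i, j} k ↔ ∀ m ∈ f.support, k ≤ m i + m j := by
    rw [mem_orderIdeal]
    simp only [Finset.sum_pair h.ne]
  constructor
  · intro hf m hm i j hij
    have hP : orderIdeal K {i, j} 1 ∈ (coverIdeal K G).minimalPrimes := by
      rw [minimalPrimes_coverIdeal]
      exact ⟨i, j, hij, rfl⟩
    have := hf ⟨_, hP⟩
    rw [contractionAtPrime_coverIdeal_pow hij k rfl] at this
    exact (hmem hij).1 this m hm
  · rintro hf ⟨P, hP⟩
    obtain ⟨i, j, hij, hPe⟩ := minimalPrimes_coverIdeal.subset hP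
    have : P.IsPrime := hP.1.1
    rw [contractionAtPrime_coverIdeal_pow hij k hPe]
    exact (hmem hij).2 fun m hm => hf m hm i j hij

theorem symbolicPowerAss_coverIdeal (k : ℕ) :
    symbolicPowerAss (coverIdeal K G) k = symbolicPowerMin (coverIdeal K G) k := by
  have h := associatedPrimes_coverIdeal (K := K) (G := G)
  rw [symbolicPowerAss, symbolicPowerMin]
  refine le_antisymm (le_iInf fun P => ?_) (le_iInf fun P => ?_)
  · exact iInf_le _ (⟨P.1, h.symm ▸ P.2⟩ : associatedPrimes _ _)
  · exact iInf_le _ (⟨P.1, h ▸ P.2⟩ : (coverIdeal K G).minimalPrimes)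

end CoverIdeal

/-! ### Odd cycles from odd closed walks -/

section OddCycle

namespace SimpleGraph.Walk

variable {V : Type*} {G : SimpleGraph V}

/-- Parity first changes when `bypass` cuts out a closed piece of odd length. That piece is an edge
followed by an even path, and the path cannot reuse the edge, since it would then have length one.
-/
theorem exists_odd_cycle_of_odd_add_length_bypass [DecidableEq V] {u v : V} (p : G.Walk u v)
    (h : Odd (p.length + p.bypass.length)) :
    ∃ (w : V) (c : G.Walk w w), c.IsCycle ∧ Odd c.length := by
  induction p with
  | nil => simp [bypass] at h
  | @cons u v' w ha p ih =>
    by_cases hp : Odd (p.length + p.bypass.length)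
    · exact ih hp
    · simp only [bypass] at h
      split_ifs at h with hs
      · have hsplit := congrArg Walk.length (p.bypass.take_spec hs)
        rw [length_append] at hsplit
        rw [length_cons] at h
        have heven : Even (p.bypass.takeUntil u hs).length := by grind
        refine ⟨u, cons ha (p.bypass.takeUntil u hs), ?_, ?_⟩
        · rw [cons_isCycle_iff]
          have hpath := (p.bypass_isPath).takeUntil hs
          refine ⟨hpath, fun hmem => ?_⟩
          rw [Sym2.eq_swap] at hmem
          rw [hpath.length_eq_one_of_mem_edges hmem] at heven
          exact absurd heven (by decide)
        · rw [length_cons]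
          exact heven.add_one
      · simp only [length_cons] at h
        grind

theorem exists_odd_cycle_of_odd_length {u : V} (p : G.Walk u u) (h : Odd p.length) :
    ∃ (w : V) (c : G.Walk w w), c.IsCycle ∧ Odd c.length := by
  classical
  refine p.exists_odd_cycle_of_odd_add_length_bypass ?_
  have : p.bypass = nil := (isPath_iff_nil.1 p.bypass_isPath).eq_nil
  simpa [this] using h

end SimpleGraph.Walk

theorem SimpleGraph.colorable_two_of_forall_cycle_not_odd {V : Type*} {G : SimpleGraph V}
    (h : ∀ (u : V) (c : G.Walk u u), c.IsCycle → ¬ Odd c.length) : G.Colorable 2 := by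
  rw [two_colorable_iff_forall_loop_even]
  intro u w
  by_contra hw
  obtain ⟨v, c, hc, hodd⟩ := w.exists_odd_cycle_of_odd_length (Nat.not_even_iff_odd.1 hw)
  exact h v c hc hodd

end OddCycle

/-! ### Fractional vertex covers -/

section FractionalCover

variable {V : Type*} [Fintype V] {G : SimpleGraph V}

theorem min_le_sum_of_two_le_add
    (hG : ∀ (u : V) (c : G.Walk u u), c.IsCycle → Odd c.length →
      ∀ i : V, ∃ j ∈ c.support, G.Adj i j)
    {t : ℕ} (ht : ∀ C : Finset V, G.IsVertexCover (C : Set V) → t ≤ C.card)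
    {w : V → ℕ} (hw : ∀ i j, G.Adj i j → 2 ≤ w i + w j) :
    min (2 * t) (Fintype.card V) ≤ ∑ v, w v := by
  classical
  by_cases h : (G.induce {v | w v = 1}).Colorable 2
  · obtain ⟨col⟩ := h
    -- An edge without an endpoint of weight at least 2 has both weights 1, hence two different
    -- colours, so each `C b` is a cover.
    let C (b : Fin 2) : Finset V :=
      Finset.univ.filter fun v => 2 ≤ w v ∨ ∃ h : w v = 1, col ⟨v, h⟩ = b
    have hC (b : Fin 2) : t ≤ (C b).card := by
      refine ht _ fun i j hij => ?_
      have := hw i j hij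
      simp only [C, Finset.coe_filter, Finset.mem_univ, true_and, Set.mem_ofPred_eq]
      by_cases hi : w i = 1
      · by_cases hj : w j = 1
        · have hne := col.valid (v := ⟨i, hi⟩) (w := ⟨j, hj⟩) hij
          by_cases hb : col ⟨i, hi⟩ = b
          · exact Or.inl (Or.inr ⟨hi, hb⟩)
          · exact Or.inr (Or.inr ⟨hj, by omega⟩)
        · exact Or.inr (Or.inl (by omega))
      · by_cases h2 : 2 ≤ w i
        · exact Or.inl (Or.inl h2)
        · exact Or.inr (Or.inl (by omega))
    refine (min_le_left _ _).trans ?_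
    calc 2 * t ≤ (C 0).card + (C 1).card := by have := hC 0; have := hC 1; omega
      _ = ∑ v, ((if v ∈ C 0 then 1 else 0) + if v ∈ C 1 then 1 else 0) := by
        rw [Finset.sum_add_distrib]; simp
      _ ≤ ∑ v, w v := by
        refine Finset.sum_le_sum fun v _ => ?_
        simp only [C, Finset.mem_filter, Finset.mem_univ, true_and]
        by_cases h2 : 2 ≤ w v
        · simp [h2]
        · by_cases h1 : w v = 1
          · by_cases hb : col ⟨v, h1⟩ = 0 <;> simp [h1, hb]
            split_ifs <;> simp
          · simp [h1, h2]
  · refine (min_le_right _ _).trans ?_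
    have : ∃ (u : _) (c : (G.induce {v | w v = 1}).Walk u u), c.IsCycle ∧ Odd c.length := by
      by_contra! hcon
      exact h (SimpleGraph.colorable_two_of_forall_cycle_not_odd fun u c hc =>
        Nat.not_odd_iff_even.2 (Nat.not_odd_iff_even.1 (hcon u c hc)))
    obtain ⟨u, c, hc, hodd⟩ := this
    have hw1 (i : V) : 1 ≤ w i := by
      let φ := (SimpleGraph.Embedding.induce (G := G) {v | w v = 1}).toHom
      obtain ⟨j, hj, hij⟩ := hG _ (c.map φ)
        (hc.map (SimpleGraph.Embedding.induce (G := G) {v | w v = 1}).injective)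
        (by simpa using hodd) i
      rw [SimpleGraph.Walk.support_map, List.mem_map] at hj
      obtain ⟨x, -, rfl⟩ := hj
      have := hw _ _ hij
      have hx : w (φ x) = 1 := x.2
      omega
    calc Fintype.card V = ∑ _v : V, 1 := by simp
      _ ≤ ∑ v, w v := Finset.sum_le_sum fun v _ => hw1 v

theorem sum_thresholds_le (k b : ℕ) :
    ∑ t ∈ Finset.Icc 1 k, ((if t ≤ b then 1 else 0) + if 2 * k < b + t then 1 else 0) ≤ b := by
  rw [Finset.sum_add_distrib, ← Finset.card_filter, ← Finset.card_filter]
  have h1 : ((Finset.Icc 1 k).filter fun t => t ≤ b).card ≤ min k b := by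
    calc _ ≤ (Finset.Icc 1 (min k b)).card := Finset.card_le_card fun t ht => by
          simp only [Finset.mem_filter, Finset.mem_Icc] at ht ⊢; omega
      _ = _ := by simp
  have h2 : ((Finset.Icc 1 k).filter fun t => 2 * k < b + t).card ≤ k - (2 * k - b) := by
    calc _ ≤ (Finset.Icc (2 * k - b + 1) k).card := Finset.card_le_card fun t ht => by
          simp only [Finset.mem_filter, Finset.mem_Icc] at ht ⊢; omega
      _ = _ := by simp
  omega

/-- Everything is doubled to stay in the integers. Each threshold `s` rounds `2 * a` to 0, 1 or 2,
with cut-offs symmetric about `k`: if `2 * a i < s`, then `2 * a j > 2 * k - s ≥ s`, so `j` gets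
weight 2. Summed over `s`, the weights at `v` total at most `2 * a v`. -/
theorem mul_min_le_two_mul_sum
    (hG : ∀ (u : V) (c : G.Walk u u), c.IsCycle → Odd c.length →
      ∀ i : V, ∃ j ∈ c.support, G.Adj i j)
    {t : ℕ} (ht : ∀ C : Finset V, G.IsVertexCover (C : Set V) → t ≤ C.card)
    {k : ℕ} {a : V → ℕ} (ha : ∀ i j, G.Adj i j → k ≤ a i + a j) :
    k * min (2 * t) (Fintype.card V) ≤ 2 * ∑ v, a v := by
  calc k * min (2 * t) (Fintype.card V)
      = ∑ _s ∈ Finset.Icc 1 k, min (2 * t) (Fintype.card V) := by simp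
    _ ≤ ∑ s ∈ Finset.Icc 1 k, ∑ v,
          ((if s ≤ 2 * a v then 1 else 0) + if 2 * k < 2 * a v + s then 1 else 0) := by
      refine Finset.sum_le_sum fun s hs => min_le_sum_of_two_le_add hG ht fun i j hij => ?_
      have := ha i j hij
      rw [Finset.mem_Icc] at hs
      split_ifs <;> omega
    _ ≤ ∑ v, 2 * a v := by
      rw [Finset.sum_comm]
      exact Finset.sum_le_sum fun v _ => sum_thresholds_le k _
    _ = 2 * ∑ v, a v := by rw [Finset.mul_sum]

end FractionalCover

/-! ### Initial degree and bounds for the v-number -/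

section Degrees

variable {K : Type*} [Field K] {V : Type*} {G : SimpleGraph V}

theorem initialDegree_coverIdeal_le_card {C : Finset V} (hC : G.IsVertexCover (C : Set V)) :
    initialDegree (coverIdeal K G) ≤ C.card := by
  refine Nat.sInf_le ⟨_, prod_X_mem_coverIdeal hC, ?_, ?_⟩
  · exact Finset.prod_ne_zero_iff.2 fun v _ => MvPolynomial.X_ne_zero v
  · simpa using MvPolynomial.IsHomogeneous.prod C (fun v => (MvPolynomial.X v : MvPolynomial V K))
      (fun _ => 1) fun v _ => MvPolynomial.isHomogeneous_X K v

variable [Fintype V] [DecidableEq V]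

theorem exists_cover_card_eq_initialDegree :
    ∃ C : Finset V, G.IsVertexCover (C : Set V) ∧ C.card = initialDegree (coverIdeal K G) := by
  have hne : {d : ℕ | ∃ f ∈ coverIdeal K G, f ≠ 0 ∧ f.IsHomogeneous d}.Nonempty := by
    refine ⟨_, _, prod_X_mem_coverIdeal (C := Finset.univ) (by simp), ?_,
      MvPolynomial.IsHomogeneous.prod Finset.univ (fun v => (MvPolynomial.X v : MvPolynomial V K))
      (fun _ => 1) fun v _ => MvPolynomial.isHomogeneous_X K v⟩
    exact Finset.prod_ne_zero_iff.2 fun v _ => MvPolynomial.X_ne_zero v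
  obtain ⟨f, hf, hf0, hhom⟩ := Nat.sInf_mem hne
  obtain ⟨m, hm⟩ := MvPolynomial.ne_zero_iff.1 hf0
  have hcover : G.IsVertexCover (m.support : Set V) := by
    intro i j hij
    have := mem_orderIdeal.1 (mem_coverIdeal.1 hf i j hij) m (MvPolynomial.mem_support_iff.2 hm)
    rw [Finset.sum_pair hij.ne] at this
    simp only [Finset.mem_coe, Finsupp.mem_support_iff]
    omega
  refine ⟨m.support, hcover, le_antisymm ?_ (initialDegree_coverIdeal_le_card hcover)⟩
  have hdeg : m.degree = initialDegree (coverIdeal K G) := by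
    rw [Finsupp.degree_eq_weight_one]
    exact hhom hm
  rw [Finsupp.degree_apply] at hdeg
  rw [← hdeg, Finset.card_eq_sum_ones]
  exact Finset.sum_le_sum fun v hv => Nat.one_le_iff_ne_zero.2 (Finsupp.mem_support_iff.1 hv)

/-- The edge `ij` is the only obstruction and is short by one, so a multiplier repairs it exactly
when each of its monomials involves `x_i` or `x_j`. -/
theorem colon_symbolicPowerMin_monomial {k : ℕ} {i j : V} (hij : G.Adj i j) {m : V →₀ ℕ}
    (hm : m i + m j + 1 = k)
    (hm' : ∀ a b, G.Adj a b → s(a, b) ≠ s(i, j) → k ≤ m a + m b) :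
    Submodule.colon (symbolicPowerMin (coverIdeal K G) k) {MvPolynomial.monomial m 1} =
      orderIdeal K {i, j} 1 := by
  ext r
  rw [Submodule.mem_colon_singleton, smul_eq_mul, mem_symbolicPowerMin_coverIdeal, mem_orderIdeal]
  simp only [Finset.sum_pair hij.ne]
  constructor
  · intro h n hn
    have := h (n + m) (by
      rw [MvPolynomial.mem_support_iff, MvPolynomial.coeff_mul_monomial, mul_one]
      exact MvPolynomial.mem_support_iff.1 hn) i j hij
    simp only [Finsupp.add_apply] at this
    omega
  · intro h n hn a b hab
    rw [MvPolynomial.mem_support_iff, MvPolynomial.coeff_mul_monomial', mul_one] at hn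
    split_ifs at hn with hle
    · obtain ⟨n, rfl⟩ := exists_add_of_le hle
      rw [add_tsub_cancel_left] at hn
      have h1 := h n (MvPolynomial.mem_support_iff.2 hn)
      simp only [Finsupp.add_apply]
      by_cases heq : s(a, b) = s(i, j)
      · rcases Sym2.eq_iff.1 heq with ⟨rfl, rfl⟩ | ⟨rfl, rfl⟩ <;> omega
      · have := hm' a b hab heq
        omega
    · exact absurd rfl hn

theorem sum_exponent_mem_vNumber_set {k : ℕ} {i j : V} (hij : G.Adj i j) {m : V →₀ ℕ}
    (hm : m i + m j + 1 = k)
    (hm' : ∀ a b, G.Adj a b → s(a, b) ≠ s(i, j) → k ≤ m a + m b) :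
    ∑ v, m v ∈ {d : ℕ | ∃ f : MvPolynomial V K, f.IsHomogeneous d ∧
      ∃ p ∈ associatedPrimes (MvPolynomial V K)
        (MvPolynomial V K ⧸ symbolicPowerMin (coverIdeal K G) k),
      Submodule.colon (symbolicPowerMin (coverIdeal K G) k) {f} = p} := by
  refine ⟨MvPolynomial.monomial m 1, ?_, _, ?_, colon_symbolicPowerMin_monomial hij hm hm'⟩
  · apply MvPolynomial.isHomogeneous_monomial
    rw [Finsupp.degree_eq_sum]
  · rw [mem_associatedPrimes_quotient]
    exact ⟨inferInstance, _, colon_symbolicPowerMin_monomial hij hm hm'⟩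

theorem exists_edge_exponent_of_minimal {C : Finset V} (hne : G ≠ ⊥)
    (hC : G.IsVertexCover (C : Set V))
    (hmin : ∀ D : Finset V, G.IsVertexCover (D : Set V) → C.card ≤ D.card) {k : ℕ} (hk : 0 < k) :
    ∃ (i j : V) (m : V →₀ ℕ), G.Adj i j ∧ m i + m j + 1 = k ∧
      (∀ a b, G.Adj a b → s(a, b) ≠ s(i, j) → k ≤ m a + m b) ∧
      ∑ v, m v ≤ k * C.card + Fintype.card V := by
  -- If no edge left `C`, any endpoint of an edge could be dropped from it, against minimality.
  obtain ⟨i, j, hij, hi, hj⟩ : ∃ i j, G.Adj i j ∧ i ∈ C ∧ j ∉ C := by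
    by_contra! hcon
    obtain ⟨a, b, hab⟩ := SimpleGraph.ne_bot_iff_exists_adj.1 hne
    have ha : a ∈ C := by
      rcases hC hab with h | h
      · exact h
      · exact hcon b a hab.symm h
    have hcov : G.IsVertexCover ((C.erase a : Finset V) : Set V) := by
      intro x y hxy
      have hxC : x ∈ C ∧ y ∈ C := by
        rcases hC hxy with h | h
        · exact ⟨h, hcon x y hxy h⟩
        · exact ⟨hcon y x hxy.symm h, h⟩
      have := hxy.ne
      simp only [Finset.mem_coe, Finset.mem_erase]
      grind
    have := hmin _ hcov
    have := Finset.card_erase_lt_of_mem ha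
    omega
  -- The value 1 outside `C` compensates for `k - 1` at `i`. Every neighbour of `j` lies in `C`, so
  -- those other than `i` carry `k`.
  refine ⟨i, j, Finsupp.equivFunOnFinite.symm fun v =>
    if v = i then k - 1 else if v = j then 0 else if v ∈ C then k else 1, hij, ?_, ?_, ?_⟩
  · simp only [Finsupp.equivFunOnFinite_symm_apply_apply, if_true, if_neg hij.ne.symm]
    omega
  · intro a b hab hne'
    have hcov : a ∈ C ∨ b ∈ C := hC hab
    have := hab.ne
    have : ¬ (a = i ∧ b = j) := by rintro ⟨rfl, rfl⟩; exact hne' rfl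
    have : ¬ (a = j ∧ b = i) := by rintro ⟨rfl, rfl⟩; exact hne' Sym2.eq_swap
    simp only [Finsupp.equivFunOnFinite_symm_apply_apply]
    grind
  · calc _ ≤ ∑ v, ((if v ∈ C then k else 0) + 1) := by
          refine Finset.sum_le_sum fun v _ => ?_
          simp only [Finsupp.equivFunOnFinite_symm_apply_apply]
          grind
      _ = _ := by
          rw [Finset.sum_add_distrib]
          simp [mul_comm]

theorem exists_edge_exponent_half (hne : G ≠ ⊥) {k : ℕ} (hk : 0 < k) :
    ∃ (i j : V) (m : V →₀ ℕ), G.Adj i j ∧ m i + m j + 1 = k ∧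
      (∀ a b, G.Adj a b → s(a, b) ≠ s(i, j) → k ≤ m a + m b) ∧
      ∑ v, m v ≤ Fintype.card V * (k / 2 + 1) := by
  obtain ⟨i, j, hij⟩ := SimpleGraph.ne_bot_iff_exists_adj.1 hne
  -- The value at `j` makes the sum on `ij` exactly `k - 1`; adding `k / 2 + 1` to it gives `k`.
  refine ⟨i, j, Finsupp.equivFunOnFinite.symm fun v =>
    if v = i then k / 2 else if v = j then k - 1 - k / 2 else k / 2 + 1, hij, ?_, ?_, ?_⟩
  · simp only [Finsupp.equivFunOnFinite_symm_apply_apply, if_true, if_neg hij.ne.symm]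
    omega
  · intro a b hab hne'
    have := hab.ne
    have : ¬ (a = i ∧ b = j) := by rintro ⟨rfl, rfl⟩; exact hne' rfl
    have : ¬ (a = j ∧ b = i) := by rintro ⟨rfl, rfl⟩; exact hne' Sym2.eq_swap
    simp only [Finsupp.equivFunOnFinite_symm_apply_apply]
    split_ifs <;> first | omega | grind
  · calc _ ≤ ∑ _v : V, (k / 2 + 1) := by
          refine Finset.sum_le_sum fun v _ => ?_
          simp only [Finsupp.equivFunOnFinite_symm_apply_apply]
          split_ifs <;> omega
      _ = _ := by simp

theorem two_mul_vNumber_le (hne : G ≠ ⊥) {k : ℕ} (hk : 0 < k) :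
    2 * vNumber (symbolicPowerMin (coverIdeal K G) k) ≤
      k * min (2 * initialDegree (coverIdeal K G)) (Fintype.card V) + 2 * Fintype.card V := by
  rcases min_cases (2 * initialDegree (coverIdeal K G)) (Fintype.card V) with ⟨h, -⟩ | ⟨h, -⟩
  · obtain ⟨C, hC, hcard⟩ := exists_cover_card_eq_initialDegree (K := K) (G := G)
    obtain ⟨i, j, m, hij, hm, hm', hsum⟩ := exists_edge_exponent_of_minimal hne hC
      (fun D hD => hcard.trans_le (initialDegree_coverIdeal_le_card hD)) hk
    have := Nat.sInf_le (sum_exponent_mem_vNumber_set (K := K) hij hm hm')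
    rw [h, ← hcard]
    change 2 * sInf _ ≤ _
    nlinarith
  · obtain ⟨i, j, m, hij, hm, hm', hsum⟩ := exists_edge_exponent_half hne hk
    have := Nat.sInf_le (sum_exponent_mem_vNumber_set (K := K) hij hm hm')
    rw [h]
    change 2 * sInf _ ≤ _
    have : 2 * (k / 2) ≤ k := by omega
    nlinarith

theorem le_two_mul_vNumber_add_two (hne : G ≠ ⊥)
    (hG : ∀ (u : V) (c : G.Walk u u), c.IsCycle → Odd c.length →
      ∀ i : V, ∃ j ∈ c.support, G.Adj i j) {k : ℕ} (hk : 0 < k) :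
    k * min (2 * initialDegree (coverIdeal K G)) (Fintype.card V) ≤
      2 * vNumber (symbolicPowerMin (coverIdeal K G) k) + 2 := by
  -- Only a witness that the infimum is attained, as `sInf ∅` would be 0.
  obtain ⟨i, j, m, hij, hm, hm', -⟩ := exists_edge_exponent_half hne hk
  obtain ⟨f, hf, p, hp, hcolon⟩ := Nat.sInf_mem ⟨_, sum_exponent_mem_vNumber_set (K := K) hij hm hm'⟩
  change f.IsHomogeneous (vNumber _) at hf
  have hprime : p.IsPrime := hp.isPrime
  have hfI : f ∉ symbolicPowerMin (coverIdeal K G) k := fun hmem => hprime.ne_top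
    (hcolon ▸ (Submodule.colon_eq_top_iff_subset _).2 (Set.singleton_subset_iff.2 hmem))
  -- This monomial lies in the symbolic power, hence in `p`, so the prime `p` contains a variable.
  have hmon : MvPolynomial.monomial (Finsupp.equivFunOnFinite.symm fun _ : V => k) (1 : K) ∈ p := by
    rw [← hcolon]
    apply Ideal.le_colon
    rw [mem_symbolicPowerMin_coverIdeal]
    intro n hn a b hab
    have := Finset.mem_singleton.1 (MvPolynomial.support_monomial_subset hn)
    simp [this]
  obtain ⟨v, hv⟩ : ∃ v, (MvPolynomial.X v : MvPolynomial V K) ∈ p := by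
    rw [MvPolynomial.monomial_eq, map_one, one_mul, Finsupp.prod, hprime.prod_mem_iff] at hmon
    obtain ⟨v, -, hv⟩ := hmon
    exact ⟨v, hprime.mem_of_pow_mem _ hv⟩
  rw [← hcolon, Submodule.mem_colon_singleton, smul_eq_mul, mem_symbolicPowerMin_coverIdeal] at hv
  have hf0 : f ≠ 0 := fun h => hfI (h ▸ zero_mem _)
  obtain ⟨n, hn⟩ := MvPolynomial.ne_zero_iff.1
    (mul_ne_zero (MvPolynomial.X_ne_zero (R := K) v) hf0)
  have hdeg : n.degree = 1 + vNumber (symbolicPowerMin (coverIdeal K G) k) := by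
    rw [Finsupp.degree_eq_weight_one]
    exact (MvPolynomial.isHomogeneous_X K v).mul hf hn
  rw [Finsupp.degree_eq_sum] at hdeg
  have := mul_min_le_two_mul_sum hG
    (fun C hC => initialDegree_coverIdeal_le_card (K := K) hC)
    (hv n (MvPolynomial.mem_support_iff.2 hn))
  omega

end Degrees

/-! ### Passage to the limit -/

theorem tendsto_vNumber_symbolicPowerMin (K : Type*) [Field K] {V : Type*} [Fintype V]
    {G : SimpleGraph V} (hne : G ≠ ⊥)
    (hG : ∀ (u : V) (c : G.Walk u u), c.IsCycle → Odd c.length →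
      ∀ i : V, ∃ j ∈ c.support, G.Adj i j) :
    Filter.Tendsto
        (fun k : ℕ => (vNumber (symbolicPowerMin (coverIdeal K G) k) : ℝ) / (k : ℝ))
        Filter.atTop
        (nhds (min (initialDegree (coverIdeal K G) : ℝ) ((Fintype.card V : ℝ) / 2))) := by
  classical
  set L : ℝ := min (initialDegree (coverIdeal K G) : ℝ) ((Fintype.card V : ℝ) / 2) with hL
  have hcast : ((min (2 * initialDegree (coverIdeal K G)) (Fintype.card V) : ℕ) : ℝ) = 2 * L := by
    rw [hL, mul_min_of_nonneg _ _ (by norm_num : (0 : ℝ) ≤ 2)]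
    push_cast
    congr 1
    ring
  have hlow : Filter.Tendsto (fun k : ℕ => L - 1 / (k : ℝ)) Filter.atTop (nhds L) := by
    simpa using tendsto_const_nhds.sub (tendsto_const_div_atTop_nhds_zero_nat (1 : ℝ))
  have hupp : Filter.Tendsto (fun k : ℕ => L + (Fintype.card V : ℝ) / (k : ℝ)) Filter.atTop
      (nhds L) := by
    simpa using tendsto_const_nhds.add (tendsto_const_div_atTop_nhds_zero_nat (Fintype.card V : ℝ))
  refine tendsto_of_tendsto_of_tendsto_of_le_of_le' hlow hupp ?_ ?_
  · filter_upwards [Filter.eventually_gt_atTop 0] with k hk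
    have hk' : (0 : ℝ) < k := Nat.cast_pos.2 hk
    have h : (k : ℝ) * (2 * L) ≤ 2 * vNumber (symbolicPowerMin (coverIdeal K G) k) + 2 := by
      rw [← hcast]
      exact_mod_cast le_two_mul_vNumber_add_two hne hG hk
    rw [le_div_iff₀ hk', sub_mul, div_mul_cancel₀ _ hk'.ne']
    linarith
  · filter_upwards [Filter.eventually_gt_atTop 0] with k hk
    have hk' : (0 : ℝ) < k := Nat.cast_pos.2 hk
    have h : 2 * (vNumber (symbolicPowerMin (coverIdeal K G) k) : ℝ) ≤
        (k : ℝ) * (2 * L) + 2 * Fintype.card V := by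
      rw [← hcast]
      exact_mod_cast two_mul_vNumber_le hne hk
    rw [div_le_iff₀ hk', add_mul, div_mul_cancel₀ _ hk'.ne']
    linarith

theorem corollary5p6 (K : Type*) [Field K] {V : Type*} [Fintype V] (G : SimpleGraph V)
    (hne : G ≠ ⊥)
    (hG : ∀ (u : V) (c : G.Walk u u), c.IsCycle → Odd c.length →
      ∀ i : V, ∃ j ∈ c.support, G.Adj i j) :
    Filter.Tendsto
        (fun k : ℕ => (vNumber (symbolicPowerAss (coverIdeal K G) k) : ℝ) / (k : ℝ))
        Filter.atTop
        (nhds (min (initialDegree (coverIdeal K G) : ℝ) ((Fintype.card V : ℝ) / 2))) ∧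
      Filter.Tendsto
        (fun k : ℕ => (vNumber (symbolicPowerMin (coverIdeal K G) k) : ℝ) / (k : ℝ))
        Filter.atTop
        (nhds (min (initialDegree (coverIdeal K G) : ℝ) ((Fintype.card V : ℝ) / 2))) := by
  classical
  have h := tendsto_vNumber_symbolicPowerMin K hne hG
  refine ⟨?_, h⟩
  simp only [symbolicPowerAss_coverIdeal]
  exact h
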